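/- Let $N,n\ge 1$ be integers, let $c_1,\dots,c_n\in\mathbf C$ with $\mathrm{Re}\,c_n>0$ and $\mathrm{Im}\,c_n>0$, and let $p(1),\dots,p(n)\in\mathbf R$ satisfy $-2\le p(1)<p(2)<\dots<p(n)$ and $p(n)>0$. Let the operator $H$ acting in $L^2(\mathbf R^N)$ be any closed extension of the operator given by $$Hf(x):=-\Delta f(x)+\sum_{m=1}^n c_m|x|^{p(m)}f(x)$$ for all $f$ in the initial domain $C_c^\infty(\mathbf R^N\setminus\{0\})$. If $z\in\mathbf C$ satisfies $0<\arg z<\arg c_n$ (principal arguments), then $\|(H-\sigma z I)^{-1}\|$ diverges to infinity faster than any power of $\sigma$ as $\sigma\to+\infty$; that is, for every $k\in\mathbf R$, $$\lim_{\sigma\to+\infty}\sigma^{-k}\,\|(H-\sigma zI)^{-1}\|=+\infty .$$ Here $\|(H-wI)^{-1}\|$ is the operator norm of the bounded two-sided inverse of $H-wI$ if $w\in\mathbf C$ is not in the spectrum of $H$, and $+\infty$ if $w$ is in the spectrum of $H$. -/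

import Mathlib

open MeasureTheory Filter Topology
open scoped Laplacian ENNReal Distributions

noncomputable section

namespace SchrodingerPseudospectrum

/-- The Hilbert space `L²(ℝ^N)` of complex-valued functions. -/
abbrev L2 (N : ℕ) : Type :=
  Lp ℂ 2 (volume : Measure (EuclideanSpace ℝ (Fin N)))

/-- The open set `ℝ^N \ {0}`. -/
def punctured (N : ℕ) : TopologicalSpace.Opens (EuclideanSpace ℝ (Fin N)) :=
  ⟨{0}ᶜ, isOpen_compl_singleton⟩

/-- The radial potential `V(x) = ∑_{m=1}^n c_m |x|^{p(m)}` on `ℝ^N`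
(its value at the origin plays no role). -/
def potential (N n : ℕ) (c : ℕ → ℂ) (p : ℕ → ℝ) (x : EuclideanSpace ℝ (Fin N)) : ℂ :=
  ∑ m ∈ Finset.Icc 1 n, c m * ((‖x‖ ^ p m : ℝ) : ℂ)

/-- The differential expression `-Δ f + V f`. -/
def schrodinger {N : ℕ} (V f : EuclideanSpace ℝ (Fin N) → ℂ) :
    EuclideanSpace ℝ (Fin N) → ℂ :=
  fun x => -(Δ f) x + V x * f x

/-- The (possibly unbounded) operator `H` in `L²(ℝ^N)` is an extension of the operator
`φ ↦ -Δ φ + V φ` with domain `C_c^∞(ℝ^N \ {0})`: every test function `φ` is, up to equality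
almost everywhere, in the domain of `H`, and `H φ = -Δ φ + V φ` almost everywhere. -/
def IsExtension {N : ℕ} (V : EuclideanSpace ℝ (Fin N) → ℂ) (H : L2 N →ₗ.[ℂ] L2 N) : Prop :=
  ∀ φ : 𝓓(punctured N, ℂ), ∃ f : H.domain,
    ((f : L2 N) : EuclideanSpace ℝ (Fin N) → ℂ) =ᵐ[volume] φ ∧
    (H f : EuclideanSpace ℝ (Fin N) → ℂ) =ᵐ[volume] schrodinger V φ

section Resolvent

variable {E : Type*} [NormedAddCommGroup E] [NormedSpace ℂ E]

/-- `R` is the resolvent `(H - w)⁻¹` of the unbounded operator `H` at `w`: a bounded operator on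
the whole space, with values in the domain of `H`, which is a two-sided inverse of `H - w`. -/
def IsResolventAt (H : E →ₗ.[ℂ] E) (w : ℂ) (R : E →L[ℂ] E) : Prop :=
  (∀ f : E, ∃ h : R f ∈ H.domain, H ⟨R f, h⟩ - w • R f = f) ∧
  ∀ g : H.domain, R (H g - w • (g : E)) = g

/-- The resolvent norm `‖(H - w)⁻¹‖`, with the convention that it is `∞` when `w` lies in the
spectrum of `H` (that is, when `H - w` has no bounded two-sided inverse). The infimum runs over
a set with at most one element. -/
def resolventNorm (H : E →ₗ.[ℂ] E) (w : ℂ) : ℝ≥0∞ :=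
  ⨅ (R : E →L[ℂ] E) (_ : IsResolventAt H w R), ‖R‖ₑ

theorem IsResolventAt.unique {H : E →ₗ.[ℂ] E} {w : ℂ} {R S : E →L[ℂ] E}
    (hR : IsResolventAt H w R) (hS : IsResolventAt H w S) : R = S := by
  ext f
  obtain ⟨h, hf⟩ := hS.1 f
  have := hR.2 ⟨S f, h⟩
  rwa [hf] at this

theorem resolventNorm_eq {H : E →ₗ.[ℂ] E} {w : ℂ} {R : E →L[ℂ] E}
    (hR : IsResolventAt H w R) : resolventNorm H w = ‖R‖ₑ :=
  le_antisymm (iInf₂_le R hR) (le_iInf₂ fun _ hS => by rw [hR.unique hS])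

theorem resolventNorm_eq_top {H : E →ₗ.[ℂ] E} {w : ℂ}
    (h : ¬ ∃ R : E →L[ℂ] E, IsResolventAt H w R) : resolventNorm H w = ∞ := by
  simp only [resolventNorm, iInf_eq_top]
  exact fun R hR => (h ⟨R, hR⟩).elim

end Resolvent

end SchrodingerPseudospectrum

end

/-! By `le_resolventNorm`, it suffices to find, for each `k`, nonzero `f` in the domain with `‖(H -
σz)f‖ ≤ σ^(-k) ‖f‖` for all large `σ`. Such `f` are radial WKB quasimodes, compactly supported in
the punctured space, so any extension acts on them by the differential expression.

Put `|x| = σ^(1/p n) s` and `h = σ^(-1/2 - 1/p n)`. Then `H - σz` becomes `-σ (h²Δ + g)`, where `g`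
tends to `g₀(s) = z - c n s^(p n)` uniformly on a small complex disc. The angle condition means `z =
E + c n t` with `E, t > 0`; so at `a = t^(1/p n)` the symbol `g₀` equals `E > 0`, and its imaginary
part on the real line passes from positive to negative. Hence `exp(-(i/h) ∫ √g₀)` has modulus peaked
at `a`.

Corrections to all orders in `h` come from a Riccati equation (`exists_approx_riccati`). Since `h`
and the lower terms of `g` involve unrelated powers of `σ`, no asymptotic series is expanded: the
Riccati equation is solved for the exact `g`, with constants uniform in `g`, and holomorphy supplies
the derivative bounds. `exists_phase` integrates the solution to a phase `U`. `exists_quasimode`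
cuts `exp U` off; the terms with derivatives of the cutoff are exponentially smaller than `f`,
because they live where the modulus is small. `exists_approx_eigenvector` supplies the scaling and
fixes the order. -/

namespace SchrodingerPseudospectrum
open Metric Complex

/-! ### Approximate solutions of a semiclassical Riccati equation -/

/-- Cauchy's estimate for the derivative on a smaller concentric disc. -/
theorem norm_deriv_le_of_ball {f : ℂ → ℂ} {a : ℂ} {r' r C : ℝ} (hr : r' < r)
    (hf : DifferentiableOn ℂ f (ball a r)) (hC : ∀ s ∈ ball a r, ‖f s‖ ≤ C) {s : ℂ}
    (hs : s ∈ ball a r') : ‖deriv f s‖ ≤ C / ((r - r') / 2) := by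
  have hd : 0 < (r - r') / 2 := by linarith
  have hsub : closedBall s ((r - r') / 2) ⊆ ball a r := by
    intro t ht
    rw [mem_closedBall] at ht
    rw [mem_ball] at hs ⊢
    linarith [dist_triangle t s a]
  refine norm_deriv_le_of_forall_mem_sphere_norm_le hd ?_ fun t ht =>
    hC t (hsub (sphere_subset_closedBall ht))
  refine DifferentiableOn.diffContOnCl ?_
  rw [closure_ball _ hd.ne']
  exact hf.mono hsub

/-- Approximate holomorphic solutions, to any order in the small parameter `h`, of the Riccati
equation `i h v' + v² = w²`, uniformly in the function `w`. -/
theorem exists_approx_riccati (a : ℂ) {m B : ℝ} (hm : 0 < m) (M : ℕ) :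
    ∀ {r' r : ℝ}, r' < r → ∃ K h₀ : ℝ, 0 ≤ K ∧ 0 < h₀ ∧ ∀ h : ℝ, 0 < h → h ≤ h₀ →
      ∀ w : ℂ → ℂ, DifferentiableOn ℂ w (ball a r) →
        (∀ s ∈ ball a r, m ≤ ‖w s‖ ∧ ‖w s‖ ≤ B) →
        ∃ v : ℂ → ℂ, DifferentiableOn ℂ v (ball a r') ∧
          (∀ s ∈ ball a r', ‖v s - w s‖ ≤ K * h) ∧
          ∀ s ∈ ball a r', ‖w s ^ 2 - v s ^ 2 - I * h * deriv v s‖ ≤ K * h ^ (M + 1) := by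
  induction M with
  | zero =>
    intro r' r hr
    refine ⟨|B| / ((r - r') / 2), 1, by have : 0 < r - r' := by linarith
                                        positivity, one_pos, fun h h0 h1 w hw hb => ?_⟩
    have hd : 0 < (r - r') / 2 := by linarith
    refine ⟨w, hw.mono (ball_subset_ball hr.le), fun s _ => ?_, fun s hs => ?_⟩
    · rw [sub_self, norm_zero]; positivity
    · have := norm_deriv_le_of_ball hr hw (fun s hs => (hb s hs).2.trans (le_abs_self B)) hs
      rw [sub_self, zero_sub, norm_neg, norm_mul, norm_mul, norm_I, one_mul, norm_real,
        Real.norm_of_nonneg h0.le, zero_add, pow_one, mul_comm]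
      gcongr
  | succ M ih =>
    intro r' r hr
    -- Each order in `h` costs some radius: half of the gap goes to the induction hypothesis, the
    -- rest to Cauchy's estimate for the correction.
    set ρ := (r' + r) / 2 with hρ
    obtain ⟨K, h₀, hK, hh₀, H⟩ := ih (r' := ρ) (r := r) (by linarith)
    have hd : 0 < (ρ - r') / 2 := by linarith
    set d := (ρ - r') / 2 with hd'
    -- The first two summands bound `v + u - w`, the last two the residual `-u² - i h u'`. The last
    -- bound on `h` gives `K h ≤ m / 2`, hence `‖v‖ ≥ m / 2`.
    refine ⟨K + K / m + (K / m) ^ 2 + K / m / d, min h₀ (min 1 (m / (2 * (K + 1)))), by positivity,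
      by positivity, fun h h0 h1 w hw hb => ?_⟩
    have hh1 : h ≤ 1 := h1.trans ((min_le_right _ _).trans (min_le_left _ _))
    have hhm : K * h ≤ m / 2 := by
      have h3 : h ≤ m / (2 * (K + 1)) := h1.trans ((min_le_right _ _).trans (min_le_right _ _))
      rw [le_div_iff₀ (by positivity)] at h3
      nlinarith
    obtain ⟨v, hv, hvw, hvR⟩ := H h h0 (h1.trans (min_le_left _ _)) w hw hb
    have hsub : ball a ρ ⊆ ball a r := ball_subset_ball (by linarith)
    have hsub' : ball a r' ⊆ ball a ρ := ball_subset_ball (by linarith)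
    have hvm : ∀ s ∈ ball a ρ, m / 2 ≤ ‖v s‖ := fun s hs => by
      have h1 := (hb s (hsub hs)).1
      have h2 := hvw s hs
      have h3 := norm_sub_norm_le (w s) (v s)
      rw [norm_sub_rev] at h3
      linarith
    have hv0 : ∀ s ∈ ball a ρ, v s ≠ 0 := fun s hs h => by
      have := hvm s hs
      rw [h, norm_zero] at this
      linarith
    -- A Newton step for the algebraic part `v²` only: the neglected `i h u'` is one order of `h`
    -- smaller than the old residual.
    set u : ℂ → ℂ := fun s => (w s ^ 2 - v s ^ 2 - I * h * deriv v s) / (2 * v s) with hu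
    have hud : DifferentiableOn ℂ u (ball a ρ) := by
      refine DifferentiableOn.div ?_ (hv.const_mul 2) fun s hs => by simpa using hv0 s hs
      exact (((hw.mono hsub).pow 2).sub (hv.pow 2)).sub
        ((hv.deriv isOpen_ball).const_mul (I * h))
    have hub : ∀ s ∈ ball a ρ, ‖u s‖ ≤ K / m * h ^ (M + 1) := fun s hs => by
      rw [hu, norm_div, norm_mul, norm_ofNat, div_le_iff₀ (by linarith [hvm s hs])]
      calc _ ≤ K * h ^ (M + 1) := hvR s hs
        _ = K / m * h ^ (M + 1) * (2 * (m / 2)) := by field_simp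
        _ ≤ _ := by gcongr; exact hvm s hs
    have hpow : h ^ (M + 1) ≤ h := by
      rw [pow_succ]
      exact mul_le_of_le_one_left h0.le (pow_le_one₀ h0.le hh1)
    refine ⟨v + u, (hv.add hud).mono hsub', fun s hs => ?_, fun s hs => ?_⟩
    · have h1 := hvw s (hsub' hs)
      have h2 := hub s (hsub' hs)
      calc ‖(v + u) s - w s‖ = ‖(v s - w s) + u s‖ := by rw [Pi.add_apply]; congr 1; ring
        _ ≤ K * h + K / m * h := (norm_add_le _ _).trans (add_le_add h1 (h2.trans (by gcongr)))
        _ ≤ (K + K / m + (K / m) ^ 2 + K / m / d) * h := by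
          have : 0 ≤ ((K / m) ^ 2 + K / m / d) * h := by positivity
          linarith
    · have hs' := hsub' hs
      have hdv := (hv.differentiableAt (isOpen_ball.mem_nhds hs')).hasDerivAt
      have hdu := (hud.differentiableAt (isOpen_ball.mem_nhds hs')).hasDerivAt
      rw [(hdv.add hdu).deriv]
      have h2 := hub s hs'
      have h3 : ‖deriv u s‖ ≤ K / m * h ^ (M + 1) / d :=
        norm_deriv_le_of_ball (by linarith) hud hub hs
      have key : w s ^ 2 - (v + u) s ^ 2 - I * h * (deriv v s + deriv u s)
          = -(u s ^ 2) - I * h * deriv u s := by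
        have : u s * (2 * v s) = w s ^ 2 - v s ^ 2 - I * h * deriv v s := by
          rw [hu]
          exact div_mul_cancel₀ _ (by simpa using hv0 s hs')
        rw [Pi.add_apply]
        linear_combination -this
      rw [key]
      calc _ ≤ ‖u s‖ ^ 2 + h * ‖deriv u s‖ := by
            refine (norm_sub_le _ _).trans (le_of_eq ?_)
            rw [norm_neg, norm_pow, norm_mul, norm_mul, norm_I, one_mul, norm_real,
              Real.norm_of_nonneg h0.le]
        _ ≤ (K / m * h ^ (M + 1)) ^ 2 + h * (K / m * h ^ (M + 1) / d) := by gcongr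
        _ = (K / m) ^ 2 * h ^ (M + 1) * h ^ (M + 1) + K / m / d * h ^ (M + 1 + 1) := by ring
        _ ≤ (K / m) ^ 2 * h ^ (M + 1) * h + K / m / d * h ^ (M + 1 + 1) := by gcongr
        _ = ((K / m) ^ 2 + K / m / d) * h ^ (M + 1 + 1) := by ring
        _ ≤ _ := by
          gcongr
          have : 0 ≤ K + K / m := by positivity
          linarith

/-! ### Principal square roots in the right half-plane -/

theorem cpow_half_sq (G : ℂ) : (G ^ (1 / 2 : ℂ)) ^ 2 = G := by
  have := cpow_nat_inv_pow G two_ne_zero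
  rwa [Nat.cast_ofNat, ← one_div] at this

/-- Halving the argument makes the real part of the root nonnegative, and its square is `Re G` plus
the square of the imaginary part. -/
theorem sqrt_le_re_cpow_half {G : ℂ} {b : ℝ} (hb : 0 < b) (hG : b ≤ G.re) :
    √b ≤ (G ^ (1 / 2 : ℂ)).re := by
  have h0 : 0 ≤ (G ^ (1 / 2 : ℂ)).re := by
    have hG0 : G ≠ 0 := fun h => by rw [h, zero_re] at hG; linarith
    rw [cpow_def_of_ne_zero hG0, exp_re]
    have : (log G * (1 / 2)).im = arg G / 2 := by
      rw [show log G * (1 / 2 : ℂ) = ((1 / 2 : ℝ) : ℂ) * log G by push_cast; ring, im_ofReal_mul,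
        log_im]
      ring
    rw [this]
    have := arg_le_pi G
    have := neg_pi_lt_arg G
    exact mul_nonneg (Real.exp_pos _).le (Real.cos_nonneg_of_mem_Icc ⟨by linarith, by linarith⟩)
  have h1 := congrArg re (cpow_half_sq G)
  rw [pow_two, mul_re] at h1
  rw [Real.sqrt_le_left h0]
  nlinarith

end SchrodingerPseudospectrum

namespace SchrodingerPseudospectrum
open Metric Complex

/-- Factor `F - G` as a difference of squares; the sum of the roots has real part at least `√b`. -/
theorem norm_cpow_half_sub_le {F G : ℂ} {b : ℝ} (hb : 0 < b) (hF : b ≤ F.re) (hG : b ≤ G.re) :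
    ‖F ^ (1 / 2 : ℂ) - G ^ (1 / 2 : ℂ)‖ ≤ ‖F - G‖ / √b := by
  have h1 := sqrt_le_re_cpow_half hb hF
  have h2 := sqrt_le_re_cpow_half hb hG
  have hs := Real.sqrt_pos.2 hb
  have h3 : √b ≤ ‖F ^ (1 / 2 : ℂ) + G ^ (1 / 2 : ℂ)‖ := by
    refine le_trans ?_ (re_le_norm _)
    rw [add_re]; linarith
  rw [le_div_iff₀ hs]
  calc _ ≤ ‖F ^ (1 / 2 : ℂ) - G ^ (1 / 2 : ℂ)‖ * ‖F ^ (1 / 2 : ℂ) + G ^ (1 / 2 : ℂ)‖ := by gcongr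
    _ = ‖(F ^ (1 / 2 : ℂ)) ^ 2 - (G ^ (1 / 2 : ℂ)) ^ 2‖ := by rw [← norm_mul]; congr 1; ring
    _ = _ := by rw [cpow_half_sq, cpow_half_sq]

/-- `Im G` is twice the product of the real and imaginary parts of the root, and the real part is
positive. This passes the sign change of `Im g₀` on to `Im √g₀`. -/
theorem im_cpow_half_mul_pos {G : ℂ} {b t : ℝ} (hb : 0 < b) (hG : b ≤ G.re) (ht : 0 < G.im * t) :
    0 < (G ^ (1 / 2 : ℂ)).im * t := by
  have h1 := (Real.sqrt_pos.2 hb).trans_le (sqrt_le_re_cpow_half hb hG)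
  have h2 := congrArg im (cpow_half_sq G)
  rw [pow_two, mul_im] at h2
  rw [← h2] at ht
  have : 0 < (2 * (G ^ (1 / 2 : ℂ)).re) * ((G ^ (1 / 2 : ℂ)).im * t) := by linarith
  exact (mul_pos_iff_of_pos_left (by positivity)).1 this

theorem norm_cpow_half_le {G : ℂ} {b : ℝ} (hG : ‖G‖ ≤ b) : ‖G ^ (1 / 2 : ℂ)‖ ≤ √b := by
  refine Real.le_sqrt_of_sq_le ?_
  rwa [← norm_pow, cpow_half_sq]

/-! ### Construction and localization of the phase -/

/-- A real function on an interval around `a`, vanishing at `a`, increasing to the left of `a` and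
decreasing to the right, is uniformly negative away from `a`. -/
theorem exists_gap_of_deriv_sign {ψ ψ' : ℝ → ℝ} {a r : ℝ}
    (hψ : ∀ s, |s - a| < r → HasDerivAt ψ (ψ' s) s) (h0 : ψ a = 0)
    (hs : ∀ s, |s - a| < r → s ≠ a → 0 < ψ' s * (a - s)) {δ : ℝ} (hδ : 0 < δ) (hδr : δ < r) :
    ∃ κ > 0, ∀ s, δ ≤ |s - a| → |s - a| < r → ψ s ≤ -κ := by
  have hcont : ∀ s, |s - a| < r → ContinuousAt ψ s := fun s h => (hψ s h).continuousAt
  have hR : StrictAntiOn ψ (Set.Ico a (a + r)) := by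
    refine strictAntiOn_of_deriv_neg (convex_Ico _ _) (fun s h => (hcont s ?_).continuousWithinAt)
      fun s h => ?_
    · rw [abs_lt]; constructor <;> linarith [h.1, h.2]
    · rw [interior_Ico] at h
      have h1 : |s - a| < r := by rw [abs_lt]; constructor <;> linarith [h.1, h.2]
      rw [(hψ s h1).deriv]
      have := hs s h1 h.1.ne'
      nlinarith [h.1]
  have hL : StrictMonoOn ψ (Set.Ioc (a - r) a) := by
    refine strictMonoOn_of_deriv_pos (convex_Ioc _ _) (fun s h => (hcont s ?_).continuousWithinAt)
      fun s h => ?_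
    · rw [abs_lt]; constructor <;> linarith [h.1, h.2]
    · rw [interior_Ioc] at h
      have h1 : |s - a| < r := by rw [abs_lt]; constructor <;> linarith [h.1, h.2]
      rw [(hψ s h1).deriv]
      have := hs s h1 h.2.ne
      nlinarith [h.2]
  have h1 : ψ (a + δ) < 0 := h0 ▸ hR ⟨le_rfl, by linarith⟩ ⟨by linarith, by linarith⟩ (by linarith)
  have h2 : ψ (a - δ) < 0 := h0 ▸ hL ⟨by linarith, by linarith⟩ ⟨by linarith, le_rfl⟩ (by linarith)
  refine ⟨min (-ψ (a + δ)) (-ψ (a - δ)), lt_min (by linarith) (by linarith), fun s hs1 hs2 => ?_⟩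
  rw [abs_lt] at hs2
  rcases le_abs.1 hs1 with h | h
  · have := hR.antitoneOn ⟨by linarith, by linarith⟩ ⟨by linarith, by linarith⟩
      (show a + δ ≤ s by linarith)
    linarith [min_le_left (-ψ (a + δ)) (-ψ (a - δ))]
  · have := hL.monotoneOn ⟨by linarith, by linarith⟩ ⟨by linarith, by linarith⟩
      (show s ≤ a - δ by linarith)
    linarith [min_le_right (-ψ (a + δ)) (-ψ (a - δ))]

theorem ofReal_mem_ball {s a r : ℝ} : (s : ℂ) ∈ ball (a : ℂ) r ↔ |s - a| < r := by
  rw [mem_ball, dist_eq, ← ofReal_sub, norm_real, Real.norm_eq_abs]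

/-- The complex phase of a semiclassical quasimode: the exponential `exp U` solves
`h² (F'' + 2ν s⁻¹ F') + g F = 0` up to `O(h ^ M)`, and it is concentrated near `a`. -/
theorem exists_phase {l : Filter ℝ} {h : ℝ → ℝ} (hpos : ∀ᶠ σ in l, 0 < h σ)
    (hlim : Tendsto h l (𝓝 0)) {a E r : ℝ} (hr : 0 < r) (hra : r < a) (hE : 0 < E) (ν : ℝ)
    {g : ℝ → ℂ → ℂ} {g₀ : ℂ → ℂ} (hg : ∀ σ, DifferentiableOn ℂ (g σ) (ball (a : ℂ) r))
    (hg₀ : DifferentiableOn ℂ g₀ (ball (a : ℂ) r))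
    (hE₀ : ∀ s ∈ ball (a : ℂ) r, ‖g₀ s - E‖ ≤ E / 4)
    (hglim : ∀ τ > 0, ∀ᶠ σ in l, ∀ s ∈ ball (a : ℂ) r, ‖g σ s - g₀ s‖ ≤ τ)
    (him : ∀ s : ℝ, |s - a| < r → s ≠ a → 0 < (g₀ s).im * (a - s)) :
    ∃ ε κ : ℝ, 0 < ε ∧ ε ≤ r / 4 ∧ 0 < κ ∧ ∀ M : ℕ, ∃ K : ℝ, 0 ≤ K ∧ ∀ᶠ σ in l,
      ∃ U : ℂ → ℂ, DifferentiableOn ℂ U (ball (a : ℂ) (3 * r / 4)) ∧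
        (∀ s ∈ ball (a : ℂ) (3 * r / 4), ‖h σ * deriv U s‖ ≤ K) ∧
        (∀ s ∈ ball (a : ℂ) (3 * r / 4),
          ‖h σ ^ 2 * (deriv (deriv U) s + deriv U s ^ 2 + 2 * ν / s * deriv U s) + g σ s‖
            ≤ K * h σ ^ (M + 1)) ∧
        (∀ s : ℝ, |s - a| ≤ ε → -κ / h σ ≤ (U s).re) ∧
        (∀ s : ℝ, r / 4 ≤ |s - a| → |s - a| < 3 * r / 4 → (U s).re ≤ -(2 * κ) / h σ) := by
  have hne : ∀ s ∈ ball (a : ℂ) r, a - r ≤ ‖s‖ := fun s hs => by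
    rw [mem_ball, dist_comm, dist_eq] at hs
    have := norm_sub_norm_le (a : ℂ) s
    rw [norm_real, Real.norm_of_nonneg (by linarith)] at this
    linarith
  have hne0 : ∀ s ∈ ball (a : ℂ) r, s ≠ 0 := fun s hs h => by
    have := hne s hs
    rw [h, norm_zero] at this
    linarith
  have har : 0 < a - r := by linarith
  have hre : ∀ x : ℂ, ‖x - E‖ ≤ E / 2 → E / 2 ≤ x.re := fun x hx => by
    have := (abs_re_le_norm (x - E)).trans hx
    rw [sub_re, ofReal_re, abs_le] at this
    linarith
  have hE2 : 0 < E / 2 := by linarith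
  set b := √(E / 2) with hb
  have hb0 : 0 < b := Real.sqrt_pos.2 hE2
  have hre₀ : ∀ s ∈ ball (a : ℂ) r, E / 2 ≤ (g₀ s).re := fun s hs =>
    hre _ ((hE₀ s hs).trans (by linarith))
  have hdiff : ∀ G : ℂ → ℂ, DifferentiableOn ℂ G (ball (a : ℂ) r) →
      (∀ s ∈ ball (a : ℂ) r, E / 2 ≤ (G s).re) →
      DifferentiableOn ℂ (fun s => G s ^ (1 / 2 : ℂ)) (ball (a : ℂ) r) := fun G hG hGE =>
    hG.cpow (differentiableOn_const _) fun s hs => Or.inl (by linarith [hGE s hs])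
  set w₀ : ℂ → ℂ := fun s => g₀ s ^ (1 / 2 : ℂ) with hw₀
  have hw₀d : DifferentiableOn ℂ w₀ (ball (a : ℂ) r) := hdiff g₀ hg₀ hre₀
  -- `P` is the limit of `h U`. On the real line `(Re P)' = Im w₀`, so `Re P` has a strict maximum
  -- at `a`.
  obtain ⟨P, hP0, hP⟩ := (hw₀d.const_mul (-I)).isExactOn_ball.with_val_at (a : ℂ) 0
  have hψ : ∀ s : ℝ, |s - a| < r → HasDerivAt (fun s : ℝ => (P s).re) (-I * w₀ s).re s :=
    fun s hs => (hP s (ofReal_mem_ball.2 hs)).real_of_complex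
  obtain ⟨κ₀, hκ₀, hgap⟩ := exists_gap_of_deriv_sign (ψ := fun s : ℝ => (P s).re)
    (ψ' := fun s : ℝ => (-I * w₀ s).re) hψ (by simp [hP0]) (fun s hs hsa => by
      have := im_cpow_half_mul_pos hE2 (hre₀ s (ofReal_mem_ball.2 hs)) (him s hs hsa)
      simpa [hw₀] using this) (δ := r / 4) (by linarith) (by linarith)
  obtain ⟨ε, hε, hεP⟩ : ∃ ε > 0, ∀ s : ℝ, |s - a| < ε → -(κ₀ / 8) < (P s).re := by
    have hc := (hψ a (by simpa using hr)).continuousAt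
    have : ∀ᶠ s : ℝ in 𝓝 a, -(κ₀ / 8) < (P s).re := by
      refine hc.eventually (lt_mem_nhds ?_)
      simp only [hP0, zero_re]
      linarith
    obtain ⟨ε, hε, H⟩ := Metric.eventually_nhds_iff.1 this
    exact ⟨ε, hε, fun s hs => H (by rwa [Real.dist_eq])⟩
  -- With `|h Re U - Re P| ≤ κ₀ / 8`, near `a` one gets `h Re U ≥ -κ₀/8 - κ₀/8`, and away from `a`,
  -- `h Re U ≤ -κ₀ + κ₀/8 ≤ -κ₀/2`.
  refine ⟨min (ε / 2) (r / 4), κ₀ / 4, by positivity, min_le_right _ _, by positivity, fun M => ?_⟩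
  obtain ⟨K, h₀, hK, hh₀, hric⟩ := exists_approx_riccati (a : ℂ) (m := b) (B := √(2 * E)) hb0 M
    (r' := 3 * r / 4) (r := r) (by linarith)
  set τ := κ₀ / (8 * r) with hτ
  have hτ0 : 0 < τ := by positivity
  refine ⟨K + √(2 * E) + τ, by positivity, ?_⟩
  have hsmall : ∀ C η : ℝ, 0 < η → ∀ᶠ σ in l, h σ * C ≤ η := fun C η hη => by
    have : Tendsto (fun σ => h σ * C) l (𝓝 0) := by simpa using hlim.mul_const C
    exact this.eventually (ge_mem_nhds hη)
  -- Since `‖G - g₀‖ ≤ 2η`, the first bound keeps `G` within `E/2` of `E`, and the second keeps `√G`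
  -- within `τ/3` of `w₀`.
  set η := min (E / 8) (b * τ / 6) with hη
  have hη0 : 0 < η := by positivity
  filter_upwards [hpos, hsmall 1 h₀ hh₀, hglim η hη0, hsmall 1 1 one_pos,
    hsmall (‖(ν - ν ^ 2 : ℂ)‖ / (a - r) ^ 2) η hη0, hsmall K (τ / 3) (by positivity),
    hsmall (‖(ν : ℂ)‖ / (a - r)) (τ / 3) (by positivity)] with σ h0 hh hgσ h1 hcor hKh hνh
  rw [mul_one] at hh h1
  set t := h σ with ht
  set G : ℂ → ℂ := fun s => g σ s + t ^ 2 * ((ν - ν ^ 2) / s ^ 2) with hG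
  have htn : ‖(t : ℂ)‖ = t := by rw [norm_real, Real.norm_of_nonneg h0.le]
  have hGd : DifferentiableOn ℂ G (ball (a : ℂ) r) := by
    refine (hg σ).add (DifferentiableOn.const_mul ?_ _)
    refine (differentiableOn_const _).div (differentiableOn_id.pow 2) fun s hs => ?_
    exact pow_ne_zero 2 (hne0 s hs)
  have hGg : ∀ s ∈ ball (a : ℂ) r, ‖G s - g₀ s‖ ≤ 2 * η := fun s hs => by
    have e : G s - g₀ s = (g σ s - g₀ s) + t ^ 2 * ((ν - ν ^ 2) / s ^ 2) := by rw [hG]; ring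
    rw [e, two_mul]
    refine (norm_add_le _ _).trans (add_le_add (hgσ s hs) (le_trans ?_ hcor))
    rw [norm_mul, norm_pow, htn, norm_div, norm_pow]
    have := hne s hs
    have : t ^ 2 ≤ t := by nlinarith
    gcongr
  have hGE : ∀ s ∈ ball (a : ℂ) r, ‖G s - E‖ ≤ E / 2 := fun s hs => by
    have := norm_add_le (G s - g₀ s) (g₀ s - E)
    rw [sub_add_sub_cancel] at this
    linarith [hGg s hs, hE₀ s hs, min_le_left (E / 8) (b * τ / 6)]
  have hGre : ∀ s ∈ ball (a : ℂ) r, E / 2 ≤ (G s).re := fun s hs => hre _ (hGE s hs)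
  have hnle : ∀ x : ℂ, ‖x - E‖ ≤ E / 2 → ‖x ^ (1 / 2 : ℂ)‖ ≤ √(2 * E) := fun x hx => by
    refine norm_cpow_half_le ?_
    have := norm_add_le (x - E) E
    rw [sub_add_cancel, norm_real, Real.norm_of_nonneg hE.le] at this
    linarith
  obtain ⟨v, hvd, hvw, hvR⟩ := hric t h0 hh (fun s => G s ^ (1 / 2 : ℂ)) (hdiff G hGd hGre)
    fun s hs => ⟨(sqrt_le_re_cpow_half hE2 (hGre s hs)).trans (re_le_norm _), hnle _ (hGE s hs)⟩
  have hsub : ball (a : ℂ) (3 * r / 4) ⊆ ball (a : ℂ) r := ball_subset_ball (by linarith)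
  have ht0 : (t : ℂ) ≠ 0 := ofReal_ne_zero.2 h0.ne'
  -- The term `-ν / s` is the factor `s^(-ν)` that removes the first-order term of the radial
  -- equation; it leaves the potential `(ν - ν²) / s²`, already included in `G`.
  set u : ℂ → ℂ := fun s => -I * v s / t - ν / s with hu
  have hud : DifferentiableOn ℂ u (ball (a : ℂ) (3 * r / 4)) :=
    ((hvd.const_mul (-I)).div_const _).sub
      ((differentiableOn_const _).div differentiableOn_id fun s hs => hne0 s (hsub hs))
  obtain ⟨U, hUa, hU⟩ := hud.isExactOn_ball.with_val_at (a : ℂ) 0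
  have hdU : ∀ s ∈ ball (a : ℂ) (3 * r / 4), deriv U s = u s := fun s hs => (hU s hs).deriv
  have hw : ∀ s ∈ ball (a : ℂ) (3 * r / 4), ‖t * u s - (-I * w₀ s)‖ ≤ τ := fun s hs => by
    have e : t * u s - (-I * w₀ s) = -I * (v s - G s ^ (1 / 2 : ℂ)) +
        -I * (G s ^ (1 / 2 : ℂ) - w₀ s) - t * (ν / s) := by
      rw [hu]; field_simp; ring
    have e1 : ‖-I * (v s - G s ^ (1 / 2 : ℂ))‖ ≤ τ / 3 := by
      rw [norm_mul, norm_neg, norm_I, one_mul]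
      exact (hvw s hs).trans (by linarith)
    have e2 : ‖-I * (G s ^ (1 / 2 : ℂ) - w₀ s)‖ ≤ τ / 3 := by
      rw [norm_mul, norm_neg, norm_I, one_mul]
      refine (norm_cpow_half_sub_le hE2 (hGre s (hsub hs)) (hre₀ s (hsub hs))).trans ?_
      rw [← hb, div_le_iff₀ hb0]
      linarith [hGg s (hsub hs), min_le_right (E / 8) (b * τ / 6)]
    have e3 : ‖t * (ν / s : ℂ)‖ ≤ τ / 3 := by
      refine le_trans ?_ hνh
      rw [norm_mul, htn, norm_div]
      have := hne s (hsub hs)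
      gcongr
    rw [e]
    linarith [norm_sub_le (-I * (v s - G s ^ (1 / 2 : ℂ)) + -I * (G s ^ (1 / 2 : ℂ) - w₀ s))
      (t * (ν / s)), norm_add_le (-I * (v s - G s ^ (1 / 2 : ℂ))) (-I * (G s ^ (1 / 2 : ℂ) - w₀ s))]
  have hUP : ∀ s ∈ ball (a : ℂ) (3 * r / 4), |t * (U s).re - (P s).re| ≤ κ₀ / 8 := fun s hs => by
    have hmv := Convex.norm_image_sub_le_of_norm_hasDerivWithin_le
      (f := fun s => t * U s - P s) (f' := fun s => t * u s - (-I * w₀ s)) (C := τ)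
      (s := ball (a : ℂ) (3 * r / 4))
      (fun x hx => (((hU x hx).const_mul (t : ℂ)).sub (hP x (hsub hx))).hasDerivWithinAt)
      hw (convex_ball _ _) (mem_ball_self (by linarith)) hs
    simp only [hUa, hP0, mul_zero, sub_zero] at hmv
    have h2 := (abs_re_le_norm _).trans hmv
    rw [sub_re, re_ofReal_mul] at h2
    rw [mem_ball, dist_eq] at hs
    calc _ ≤ τ * ‖s - a‖ := h2
      _ ≤ τ * r := by gcongr; linarith
      _ = κ₀ / 8 := by rw [hτ]; field_simp
  refine ⟨U, fun s hs => (hU s hs).differentiableAt.differentiableWithinAt, fun s hs => ?_,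
    fun s hs => ?_, fun s hs => ?_, fun s hs1 hs2 => ?_⟩
  · rw [hdU s hs]
    have h2 := norm_add_le (t * u s - (-I * w₀ s)) (-I * w₀ s)
    rw [sub_add_cancel] at h2
    have h3 : ‖-I * w₀ s‖ ≤ √(2 * E) := by
      rw [norm_mul, norm_neg, norm_I, one_mul]
      exact hnle _ ((hE₀ s (hsub hs)).trans (by linarith))
    linarith [hw s hs]
  · have hdd : deriv (deriv U) s = deriv u s :=
      (Filter.eventuallyEq_of_mem (isOpen_ball.mem_nhds hs) hdU).deriv_eq
    have hs0 := hne0 s (hsub hs)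
    have hdu : deriv u s = -I * deriv v s / t + ν / s ^ 2 := by
      have h1 := (hvd.differentiableAt (isOpen_ball.mem_nhds hs)).hasDerivAt
      have h2 := ((h1.const_mul (-I)).div_const (t : ℂ)).sub
        ((hasDerivAt_inv hs0).const_mul (ν : ℂ))
      have h3 : u = (fun s => -I * v s / t) - fun s => (ν : ℂ) * s⁻¹ := by
        ext x; simp [hu, div_eq_mul_inv]
      rw [h3, h2.deriv]
      ring
    have e : t ^ 2 * (deriv (deriv U) s + deriv U s ^ 2 + 2 * ν / s * deriv U s) + g σ s
        = G s - v s ^ 2 - I * t * deriv v s := by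
      have : g σ s = G s - t ^ 2 * ((ν - ν ^ 2) / s ^ 2) := by rw [hG]; ring
      rw [hdd, hdu, hdU s hs, hu, this]
      field_simp
      ring_nf
      rw [I_sq]
      ring
    rw [e]
    have h2 := hvR s hs
    rw [cpow_half_sq] at h2
    refine h2.trans ?_
    gcongr
    linarith [Real.sqrt_nonneg (2 * E)]
  · have h2 := hεP s (by linarith [min_le_left (ε / 2) (r / 4)])
    have h3 := hUP s (ofReal_mem_ball.2 (by linarith [min_le_right (ε / 2) (r / 4)]))
    rw [abs_le] at h3
    rw [div_le_iff₀ h0]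
    linarith
  · have h2 := hgap s hs1 (by linarith)
    have h3 := hUP s (ofReal_mem_ball.2 hs2)
    rw [abs_le] at h3
    rw [le_div_iff₀ h0]
    linarith

end SchrodingerPseudospectrum

namespace SchrodingerPseudospectrum

/-! ### Calculus of radial functions -/

section Radial

variable {E : Type*} [NormedAddCommGroup E] [InnerProductSpace ℝ E]

theorem hasFDerivAt_norm_of_ne_zero {x : E} (hx : x ≠ 0) :
    HasFDerivAt (fun y : E => ‖y‖) (‖x‖⁻¹ • innerSL ℝ x) x := by
  have h0 : ‖x‖ ≠ 0 := norm_ne_zero_iff.2 hx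
  have h := (hasStrictFDerivAt_norm_sq x).hasFDerivAt.sqrt (pow_ne_zero 2 h0)
  simp only [Real.sqrt_sq (norm_nonneg _)] at h
  convert h using 1
  ext y
  simp
  field_simp

/-- The Laplacian of a radial function, away from the origin. -/
theorem laplacian_comp_norm [FiniteDimensional ℝ E] {F F' : ℝ → ℂ} {F'' : ℂ} {x : E} (hx : x ≠ 0)
    (hF : ∀ᶠ r in 𝓝 ‖x‖, HasDerivAt F (F' r) r) (hF' : HasDerivAt F' F'' ‖x‖) :
    (Δ fun y : E => F ‖y‖) x
      = F'' + ((Module.finrank ℝ E : ℂ) - 1) / (‖x‖ : ℂ) * F' ‖x‖ := by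
  have h0 : ‖x‖ ≠ 0 := norm_ne_zero_iff.2 hx
  have h0' : (‖x‖ : ℂ) ≠ 0 := by exact_mod_cast h0
  -- The gradient at `y` is `Q(‖y‖) y`; differentiating once more and tracing over an orthonormal
  -- basis, Parseval sums the squares `⟪x, e⟫²` to `‖x‖²`.
  set Q : ℝ → ℂ := fun r => F' r * (r : ℂ)⁻¹ with hQ
  have hQd : HasDerivAt Q (F'' * (‖x‖ : ℂ)⁻¹ + F' ‖x‖ * (-((‖x‖ : ℂ) ^ 2)⁻¹)) ‖x‖ := by
    have := (hasDerivAt_inv h0').comp_ofReal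
    exact hF'.mul this
  have h1 : ∀ᶠ y in 𝓝 x, ∀ e : E, fderiv ℝ (fun y : E => F ‖y‖) y e
      = Q ‖y‖ * ((inner ℝ y e : ℝ) : ℂ) := by
    filter_upwards [continuous_norm.continuousAt.eventually hF, isOpen_ne.mem_nhds hx]
      with y hy hy0 e
    have h := hy.hasFDerivAt.comp y (hasFDerivAt_norm_of_ne_zero hy0)
    have e1 : fderiv ℝ (fun y : E => F ‖y‖) y = _ := h.fderiv
    rw [e1]
    simp [hQ]
    ring
  have h2 : ∀ e : E, fderiv ℝ (fderiv ℝ (fun y : E => F ‖y‖)) x e e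
      = (F'' * (‖x‖ : ℂ)⁻¹ + F' ‖x‖ * (-((‖x‖ : ℂ) ^ 2)⁻¹)) * (‖x‖ : ℂ)⁻¹
          * ((inner ℝ x e : ℝ) : ℂ) ^ 2 + Q ‖x‖ * (‖e‖ : ℂ) ^ 2 := by
    intro e
    have hd : DifferentiableAt ℝ (fderiv ℝ (fun y : E => F ‖y‖)) x := by
      have h3 : fderiv ℝ (fun y : E => F ‖y‖) =ᶠ[𝓝 x]
          fun y => Q ‖y‖ • Complex.ofRealCLM.comp (innerSL ℝ y) := by
        filter_upwards [h1] with y hy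
        ext e
        rw [hy]
        simp [mul_comm]
      refine DifferentiableAt.congr_of_eventuallyEq ?_ h3
      have hq : DifferentiableAt ℝ (fun y : E => Q ‖y‖) x :=
        hQd.differentiableAt.comp x (hasFDerivAt_norm_of_ne_zero hx).differentiableAt
      have hi : DifferentiableAt ℝ (fun y : E => Complex.ofRealCLM.comp (innerSL ℝ y)) x :=
        (differentiableAt_const _).clm_comp (innerSL ℝ).differentiableAt
      exact hq.smul hi
    have h4 : fderiv ℝ (fderiv ℝ (fun y : E => F ‖y‖)) x e e
        = fderiv ℝ (fun y => fderiv ℝ (fun y : E => F ‖y‖) y e) x e := by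
      have := hd.hasFDerivAt.clm_apply (hasFDerivAt_const e x)
      rw [this.fderiv]
      simp
    have h5 : (fun y => fderiv ℝ (fun y : E => F ‖y‖) y e) =ᶠ[𝓝 x]
        fun y => Q ‖y‖ * ((inner ℝ y e : ℝ) : ℂ) := h1.mono fun y hy => hy e
    have h6 := hQd.hasFDerivAt.comp x (hasFDerivAt_norm_of_ne_zero hx)
    have h7 : HasFDerivAt (fun y : E => ((inner ℝ y e : ℝ) : ℂ))
        (Complex.ofRealCLM.comp (innerSL ℝ e)) x := by
      have : (fun y : E => ((inner ℝ y e : ℝ) : ℂ)) = Complex.ofRealCLM.comp (innerSL ℝ e) := by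
        ext y; simp [real_inner_comm]
      rw [this]
      exact ContinuousLinearMap.hasFDerivAt _
    have h8 : fderiv ℝ (fun y => Q ‖y‖ * ((inner ℝ y e : ℝ) : ℂ)) x = _ := (h6.mul h7).fderiv
    rw [h4, h5.fderiv_eq, h8]
    simp
    ring
  rw [InnerProductSpace.laplacian_eq_iteratedFDeriv_stdOrthonormalBasis]
  simp only [iteratedFDeriv_two_apply, Matrix.cons_val_zero, Matrix.cons_val_one, h2,
    OrthonormalBasis.norm_eq_one]
  rw [Finset.sum_add_distrib, ← Finset.mul_sum]
  have h9 : ∑ i, ((inner ℝ x (stdOrthonormalBasis ℝ E i) : ℝ) : ℂ) ^ 2 = (‖x‖ : ℂ) ^ 2 := by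
    have := (stdOrthonormalBasis ℝ E).sum_sq_norm_inner_left x
    rw [← Complex.ofReal_pow, ← this]
    push_cast
    refine Finset.sum_congr rfl fun i _ => ?_
    rw [← Complex.ofReal_pow, ← Complex.ofReal_pow, Real.norm_eq_abs, sq_abs]
  rw [h9]
  simp [hQ]
  field_simp
  ring

theorem contDiff_comp_norm {F : ℝ → ℂ} (hF : ContDiff ℝ (⊤ : ℕ∞) F) (h0 : F =ᶠ[𝓝 0] 0) :
    ContDiff ℝ (⊤ : ℕ∞) fun x : E => F ‖x‖ := by
  rw [contDiff_iff_contDiffAt]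
  intro x
  by_cases hx : x = 0
  · have h1 : (fun x : E => F ‖x‖) =ᶠ[𝓝 x] fun _ => 0 := by
      have : Tendsto (fun x : E => ‖x‖) (𝓝 x) (𝓝 0) := by
        simpa [hx] using (continuous_norm (E := E)).tendsto x
      exact this.eventually h0
    exact contDiffAt_const.congr_of_eventuallyEq h1
  · exact hF.contDiffAt.comp x (contDiffAt_norm ℝ hx)

end Radial

/-! ### Comparison of `L²` norms -/

section L2

variable {N : ℕ}

/-- Comparison of `L²` norms on `ℝ^N`, when `g` is dominated by a small multiple of `f` up to an
error supported in a ball, and `f` is bounded below on some other ball. -/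
theorem norm_le_of_ae_le_add_indicator {f g : L2 N} {A B m R₁ R₂ : ℝ} (hA : 0 ≤ A) (hB : 0 ≤ B)
    (hm : 0 < m) (hR₂ : 0 < R₂) (hR : R₂ ≤ R₁) (y : EuclideanSpace ℝ (Fin N))
    (hg : ∀ᵐ x, ‖g x‖ ≤ A * ‖f x‖ + (Metric.ball 0 R₁).indicator (fun _ => B) x)
    (hf : ∀ᵐ x, x ∈ Metric.ball y R₂ → m ≤ ‖f x‖) :
    0 < ‖f‖ ∧ ‖g‖ ≤ (A + B / m * (R₁ / R₂) ^ N) * ‖f‖ := by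
  have hR₁ : 0 < R₁ := hR₂.trans_le hR
  set b₁ := Metric.ball (0 : EuclideanSpace ℝ (Fin N)) R₁ with hb₁
  set b₂ := Metric.ball y R₂ with hb₂
  set I₁ : Lp ℝ 2 (volume : Measure (EuclideanSpace ℝ (Fin N))) :=
    indicatorConstLp 2 (s := b₁) measurableSet_ball measure_ball_lt_top.ne B
  set I₂ : Lp ℝ 2 (volume : Measure (EuclideanSpace ℝ (Fin N))) :=
    indicatorConstLp 2 (s := b₂) measurableSet_ball measure_ball_lt_top.ne m
  set F : Lp ℝ 2 (volume : Measure (EuclideanSpace ℝ (Fin N))) := (Lp.memLp f).norm.toLp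
  have hF : ∀ᵐ x, F x = ‖f x‖ := (Lp.memLp f).norm.coeFn_toLp
  have hFn : ‖F‖ = ‖f‖ := by
    rw [Lp.norm_toLp, eLpNorm_norm, Lp.norm_def]
  have h1 : ‖g‖ ≤ ‖A • F + I₁‖ := by
    refine Lp.norm_le_norm_of_ae_le ?_
    filter_upwards [hg, hF, Lp.coeFn_add (A • F) I₁, Lp.coeFn_smul A F,
      indicatorConstLp_coeFn (p := 2) (hs := measurableSet_ball)
        (hμs := (measure_ball_lt_top (μ := volume) (x := (0 : EuclideanSpace ℝ (Fin N)))
          (r := R₁)).ne) (c := B)] with x h1 h2 h3 h4 h5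
    rw [h3, Pi.add_apply, h4, Pi.smul_apply, h2, smul_eq_mul]
    refine h1.trans (le_trans (le_of_eq ?_) (le_abs_self _))
    rw [h5]
  have h2 : ‖I₂‖ ≤ ‖f‖ := by
    refine Lp.norm_le_norm_of_ae_le ?_
    filter_upwards [hf, indicatorConstLp_coeFn (p := 2) (hs := measurableSet_ball)
        (hμs := (measure_ball_lt_top (μ := volume) (x := y) (r := R₂)).ne) (c := m)] with x h1 h2
    rw [h2]
    by_cases hx : x ∈ b₂
    · rw [Set.indicator_of_mem hx, Real.norm_of_nonneg hm.le]
      exact h1 hx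
    · rw [Set.indicator_of_notMem hx, norm_zero]
      exact norm_nonneg _
  have hv : ∀ (x : EuclideanSpace ℝ (Fin N)) {r : ℝ}, 0 < r → volume.real (Metric.ball x r)
      = r ^ N * volume.real (Metric.ball (0 : EuclideanSpace ℝ (Fin N)) 1) := fun x r hr => by
    rw [Measure.real, Measure.addHaar_ball_of_pos _ _ hr, finrank_euclideanSpace_fin,
      ENNReal.toReal_mul, ENNReal.toReal_ofReal (by positivity), Measure.real]
  have hI₁ : ‖I₁‖ = B * volume.real b₁ ^ (1 / (2 : ℝ≥0∞).toReal) := by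
    rw [norm_indicatorConstLp (by norm_num) (by norm_num), Real.norm_of_nonneg hB]
  have hI₂ : ‖I₂‖ = m * volume.real b₂ ^ (1 / (2 : ℝ≥0∞).toReal) := by
    rw [norm_indicatorConstLp (by norm_num) (by norm_num), Real.norm_of_nonneg hm.le]
  have hq : 1 ≤ (R₁ / R₂) ^ N := one_le_pow₀ ((one_le_div hR₂).2 hR)
  -- The sharp ratio is `(R₁ / R₂) ^ (N / 2)`; as `R₁ / R₂ ≥ 1`, the exponent `N` is a harmless
  -- weakening.
  have h3 : volume.real b₁ ^ (1 / (2 : ℝ≥0∞).toReal)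
      ≤ (R₁ / R₂) ^ N * volume.real b₂ ^ (1 / (2 : ℝ≥0∞).toReal) := by
    have : volume.real b₁ = (R₁ / R₂) ^ N * volume.real b₂ := by
      rw [hv _ hR₁, hv _ hR₂, div_pow]
      field_simp
    rw [this, Real.mul_rpow (by positivity) measureReal_nonneg]
    gcongr
    exact Real.rpow_le_self_of_one_le hq (by norm_num)
  have h4 : 0 < ‖I₂‖ := by
    have : 0 < volume.real b₂ :=
      ENNReal.toReal_pos (Metric.measure_ball_pos _ _ hR₂).ne' measure_ball_lt_top.ne
    rw [hI₂]
    positivity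
  refine ⟨h4.trans_le h2, ?_⟩
  calc ‖g‖ ≤ A * ‖F‖ + ‖I₁‖ := by
        refine h1.trans ((norm_add_le _ _).trans (le_of_eq ?_))
        rw [norm_smul, Real.norm_of_nonneg hA]
    _ ≤ A * ‖f‖ + B / m * (R₁ / R₂) ^ N * ‖I₂‖ := by
        rw [hFn, hI₁, hI₂]
        have : B / m * (R₁ / R₂) ^ N * (m * volume.real b₂ ^ (1 / (2 : ℝ≥0∞).toReal))
            = B * ((R₁ / R₂) ^ N * volume.real b₂ ^ (1 / (2 : ℝ≥0∞).toReal)) := by field_simp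
        rw [this]
        gcongr
    _ ≤ A * ‖f‖ + B / m * (R₁ / R₂) ^ N * ‖f‖ := by gcongr
    _ = _ := by ring

end L2

end SchrodingerPseudospectrum

namespace SchrodingerPseudospectrum
open Metric

/-! ### From a phase to a quasimode -/

/-- A dilated radial profile supported away from the origin, as a test function. -/
theorem exists_radial_testFunction (N : ℕ) {Φ : ℝ → ℂ} (hΦ : ContDiff ℝ (⊤ : ℕ∞) Φ) {a ρ L : ℝ}
    (hρ : ρ < a) (hL : 0 < L) (h0 : ∀ s, ρ ≤ |s - a| → Φ s = 0) :
    ∃ φ : 𝓓(punctured N, ℂ), ∀ x, φ x = Φ (‖x‖ / L) := by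
  have hz : ∀ᶠ t : ℝ in 𝓝 0, Φ (t / L) = 0 := by
    filter_upwards [gt_mem_nhds (show 0 < L * (a - ρ) by nlinarith)] with t ht
    refine h0 _ ?_
    rw [abs_sub_comm]
    refine le_trans ?_ (le_abs_self _)
    have : t / L < a - ρ := by rw [div_lt_iff₀ hL]; linarith
    linarith
  have hsupp : ∀ x : EuclideanSpace ℝ (Fin N), Φ (‖x‖ / L) ≠ 0 →
      L * (a - ρ) ≤ ‖x‖ ∧ ‖x‖ ≤ L * (a + ρ) := fun x hx => by
    have h1 : |‖x‖ / L - a| < ρ := by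
      by_contra! h
      exact hx (h0 _ h)
    rw [abs_lt] at h1
    have e : ‖x‖ = L * (‖x‖ / L) := by field_simp
    constructor
    · rw [e]; gcongr; linarith
    · rw [e]; gcongr; linarith
  refine ⟨⟨fun x => Φ (‖x‖ / L), ?_, ?_, ?_⟩, fun x => rfl⟩
  · exact contDiff_comp_norm (F := fun t => Φ (t / L)) (hΦ.comp (contDiff_id.div_const L)) hz
  · refine HasCompactSupport.of_support_subset_isCompact
      (isCompact_closedBall (0 : EuclideanSpace ℝ (Fin N)) (L * (a + ρ))) fun x hx => ?_
    rw [mem_closedBall_zero_iff]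
    exact (hsupp x hx).2
  · have h1 : tsupport (fun x : EuclideanSpace ℝ (Fin N) => Φ (‖x‖ / L))
        ⊆ {x | L * (a - ρ) ≤ ‖x‖} :=
      closure_minimal (fun x hx => (hsupp x hx).1)
        (isClosed_le continuous_const continuous_norm)
    intro x hx
    have h2 := h1 hx
    have h3 : 0 < L * (a - ρ) := mul_pos hL (by linarith)
    show x ≠ 0
    rintro rfl
    rw [Set.mem_ofPred_eq, norm_zero] at h2
    linarith

/-- The derivatives of `χ exp U` for a real cutoff `χ` and a holomorphic phase `U`. -/
theorem hasDerivAt_mul_cexp {χ : ℝ → ℝ} (hχ : ContDiff ℝ (⊤ : ℕ∞) χ) {U : ℂ → ℂ} {O : Set ℂ}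
    (hO : IsOpen O) (hU : DifferentiableOn ℂ U O) {s : ℝ} (hs : (s : ℂ) ∈ O) :
    HasDerivAt (fun s : ℝ => (χ s : ℂ) * Complex.exp (U s))
      (((deriv χ s : ℝ) + χ s * deriv U s) * Complex.exp (U s)) s ∧
    HasDerivAt (fun s : ℝ => ((deriv χ s : ℝ) + χ s * deriv U s) * Complex.exp (U s))
      (((deriv (deriv χ) s : ℝ) + 2 * (deriv χ s : ℝ) * deriv U s
        + χ s * (deriv (deriv U) s + deriv U s ^ 2)) * Complex.exp (U s)) s := by
  have hχ1 : HasDerivAt (fun s : ℝ => (χ s : ℂ)) ((deriv χ s : ℝ) : ℂ) s :=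
    ((hχ.differentiable (by simp)) s).hasDerivAt.ofReal_comp
  have hχ' : ContDiff ℝ (⊤ : ℕ∞) (deriv χ) := (contDiff_infty_iff_deriv.1 hχ).2
  have hχ2 : HasDerivAt (fun s : ℝ => ((deriv χ s : ℝ) : ℂ)) ((deriv (deriv χ) s : ℝ) : ℂ) s :=
    ((hχ'.differentiable (by simp)) s).hasDerivAt.ofReal_comp
  have hU1 : HasDerivAt (fun s : ℝ => U s) (deriv U s) s :=
    (hU.differentiableAt (hO.mem_nhds hs)).hasDerivAt.comp_ofReal
  have hU2 : HasDerivAt (fun s : ℝ => deriv U s) (deriv (deriv U) s) s :=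
    ((hU.deriv hO).differentiableAt (hO.mem_nhds hs)).hasDerivAt.comp_ofReal
  refine ⟨(hχ1.mul hU1.cexp).congr_deriv (by ring),
    ((hχ2.add (hχ1.mul hU2)).mul hU1.cexp).congr_deriv
      (by simp only [Pi.add_apply, Pi.mul_apply]; ring)⟩

/-- `U` is uncontrolled outside the disc, but the cutoff vanishes before its edge is reached. -/
theorem contDiff_mul_cexp {χ : ℝ → ℝ} (hχ : ContDiff ℝ (⊤ : ℕ∞) χ) {U : ℂ → ℂ} {a R ρ : ℝ}
    (hρ : ρ < R) (hχ0 : ∀ s, ρ ≤ |s - a| → χ s = 0) (hU : DifferentiableOn ℂ U (ball (a : ℂ) R)) :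
    ContDiff ℝ (⊤ : ℕ∞) fun s : ℝ => (χ s : ℂ) * Complex.exp (U s) := by
  rw [contDiff_iff_contDiffAt]
  intro s
  rcases lt_or_ge ρ |s - a| with hs | hs
  · have : (fun s : ℝ => (χ s : ℂ) * Complex.exp (U s)) =ᶠ[𝓝 s] fun _ => 0 := by
      have hc : ContinuousAt (fun s : ℝ => |s - a|) s := by fun_prop
      filter_upwards [hc.eventually (lt_mem_nhds hs)] with t ht
      rw [hχ0 t ht.le, Complex.ofReal_zero, zero_mul]
    exact contDiffAt_const.congr_of_eventuallyEq this
  · have hmem : (s : ℂ) ∈ ball (a : ℂ) R := ofReal_mem_ball.2 (hs.trans_lt hρ)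
    have hUs : ContDiffAt ℂ (⊤ : ℕ∞) U s := hU.analyticAt (isOpen_ball.mem_nhds hmem) |>.contDiffAt
    have hUr : ContDiffAt ℝ (⊤ : ℕ∞) (fun s : ℝ => U s) s :=
      (hUs.restrict_scalars ℝ).comp s Complex.ofRealCLM.contDiff.contDiffAt
    exact (Complex.ofRealCLM.contDiff.contDiffAt.comp s hχ.contDiffAt).mul hUr.cexp

/-- A localized approximate solution of the radial equation yields an approximate eigenvector
of any extension `H`. -/
theorem exists_quasimode {N : ℕ} (hN : 1 ≤ N) {V : EuclideanSpace ℝ (Fin N) → ℂ}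
    {H : L2 N →ₗ.[ℂ] L2 N} (hH : IsExtension V H) {σ h L a r ε κ K η C : ℝ} {z : ℂ}
    (hσ : 0 < σ) (hh : 0 < h) (hh1 : h ≤ 1) (hL : 0 < L) (hσL : σ * h ^ 2 * L ^ 2 = 1)
    (hr : 0 < r) (hra : r < a) (hε : 0 < ε) (hεr : ε ≤ r / 4) (hK : 0 ≤ K) (hη : 0 ≤ η)
    {χ : ContDiffBump a} (hχin : χ.rIn = r / 4) (hχout : χ.rOut = r / 2)
    (hC1 : ∀ s, |deriv χ s| ≤ C) (hC2 : ∀ s, |deriv (deriv χ) s| ≤ C)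
    {U g : ℂ → ℂ} (hU : DifferentiableOn ℂ U (ball (a : ℂ) (3 * r / 4)))
    (hV : ∀ s : ℝ, |s - a| < 3 * r / 4 → ∀ x, ‖x‖ = L * s → V x = σ * (z - g s))
    (hUK : ∀ s ∈ ball (a : ℂ) (3 * r / 4), ‖h * deriv U s‖ ≤ K)
    (hUη : ∀ s ∈ ball (a : ℂ) (3 * r / 4),
      ‖h ^ 2 * (deriv (deriv U) s + deriv U s ^ 2
        + 2 * (((N : ℝ) - 1) / 2 : ℝ) / s * deriv U s) + g s‖ ≤ η)
    (hlow : ∀ s : ℝ, |s - a| ≤ ε → -κ / h ≤ (U s).re)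
    (hup : ∀ s : ℝ, r / 4 ≤ |s - a| → |s - a| < 3 * r / 4 → (U s).re ≤ -(2 * κ) / h) :
    ∃ f : H.domain, 0 < ‖(f : L2 N)‖ ∧ ‖H f - ((σ : ℂ) * z) • (f : L2 N)‖ ≤
      σ * (η + (C + 2 * C * K + |(N : ℝ) - 1| / (a - r) * C) * Real.exp (-κ / h)
        * ((a + r) / ε) ^ N) * ‖(f : L2 N)‖ := by
  have hC0 : 0 ≤ C := (abs_nonneg _).trans (hC1 a)
  have har : 0 < a - r := by linarith
  have hχs : ContDiff ℝ (⊤ : ℕ∞) χ := χ.contDiff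
  have hχ0 : ∀ s, r / 2 ≤ |s - a| → χ s = 0 := fun s hs =>
    χ.zero_of_le_dist (by rwa [hχout, Real.dist_eq])
  have hχ1 : ∀ s, |s - a| ≤ r / 4 → χ s = 1 := fun s hs =>
    χ.one_of_mem_closedBall (by rwa [hχin, mem_closedBall, Real.dist_eq])
  set Φ : ℝ → ℂ := fun s => (χ s : ℂ) * Complex.exp (U s) with hΦ
  have hΦs : ContDiff ℝ (⊤ : ℕ∞) Φ := contDiff_mul_cexp hχs (by linarith) hχ0 hU
  obtain ⟨φ, hφ⟩ := exists_radial_testFunction N hΦs (a := a) (ρ := r / 2) (by linarith) hL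
    fun s hs => by rw [hΦ]; simp [hχ0 s hs]
  obtain ⟨f, hf, hHf⟩ := hH φ
  set B := C + 2 * C * K + |(N : ℝ) - 1| / (a - r) * C with hB
  have hB0 : 0 ≤ B := by positivity
  set y : EuclideanSpace ℝ (Fin N) := EuclideanSpace.single ⟨0, hN⟩ (L * a) with hy
  have hyn : ‖y‖ = L * a := by
    rw [hy, PiLp.norm_single, Real.norm_of_nonneg (by nlinarith)]
  have hnormφ : ∀ x, ‖φ x‖ = |χ (‖x‖ / L)| * Real.exp (U (‖x‖ / L : ℝ)).re := fun x => by
    rw [hφ, hΦ, norm_mul, Complex.norm_exp, Complex.norm_real, Real.norm_eq_abs]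
  -- The cutoff error is of size `exp(-2κ/h)`, while `‖f‖ ≥ exp(-κ/h)` on a ball of radius `L ε`
  -- around `y`; the quotient keeps one factor `exp(-κ/h)`.
  have hmain := norm_le_of_ae_le_add_indicator (f := (f : L2 N))
    (g := H f - ((σ : ℂ) * z) • (f : L2 N)) (A := σ * η) (B := σ * B * Real.exp (-(2 * κ) / h))
    (m := Real.exp (-κ / h)) (R₁ := L * (a + r)) (R₂ := L * ε) (by positivity) (by positivity)
    (Real.exp_pos _) (by positivity) (by gcongr; linarith) y ?_ ?_
  · refine ⟨f, hmain.1, hmain.2.trans (le_of_eq ?_)⟩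
    have e1 : Real.exp (-(2 * κ) / h) = Real.exp (-κ / h) * Real.exp (-κ / h) := by
      rw [← Real.exp_add]; congr 1; ring
    have e2 : L * (a + r) / (L * ε) = (a + r) / ε := by field_simp
    rw [e1, e2]
    have := (Real.exp_pos (-κ / h)).ne'
    field_simp
  · filter_upwards [hf, hHf, Lp.coeFn_sub (H f) (((σ : ℂ) * z) • (f : L2 N)),
      Lp.coeFn_smul ((σ : ℂ) * z) (f : L2 N)] with x h1 h2 h3 h4
    rw [h3, Pi.sub_apply, h4, Pi.smul_apply, h1, h2, smul_eq_mul, schrodinger]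
    have hind : 0 ≤ (ball (0 : EuclideanSpace ℝ (Fin N)) (L * (a + r))).indicator
        (fun _ => σ * B * Real.exp (-(2 * κ) / h)) x :=
      Set.indicator_nonneg (fun _ _ => by positivity) _
    set s := ‖x‖ / L with hs
    have hxs : ‖x‖ = L * s := by rw [hs]; field_simp
    have hφf : (φ : EuclideanSpace ℝ (Fin N) → ℂ) = fun y => (fun t => Φ (t / L)) ‖y‖ :=
      funext hφ
    rcases lt_or_ge |s - a| (3 * r / 4) with hsr | hsr
    · have hs0 : 0 < s := by rw [abs_lt] at hsr; linarith
      have hsra : a - r ≤ s := by rw [abs_lt] at hsr; linarith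
      have hx0 : x ≠ 0 := by
        rw [← norm_pos_iff, hxs]; positivity
      have hmem : (s : ℂ) ∈ ball (a : ℂ) (3 * r / 4) := ofReal_mem_ball.2 hsr
      have hlap : (Δ ⇑φ) x = ((L : ℂ) ^ 2)⁻¹ * ((((deriv (deriv χ) s : ℝ) + 2 * (deriv χ s : ℝ) * deriv U s
          + χ s * (deriv (deriv U) s + deriv U s ^ 2)) * Complex.exp (U s))
          + ((N : ℂ) - 1) / s * (((deriv χ s : ℝ) + χ s * deriv U s) * Complex.exp (U s))) := by
        rw [hφf]
        have hdil : ∀ t : ℝ, HasDerivAt (fun t : ℝ => t / L) (1 / L) t := fun t =>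
          (hasDerivAt_id t).div_const L
        rw [laplacian_comp_norm (F := fun t => Φ (t / L))
          (F' := fun t => (1 / L) • (((deriv χ (t / L) : ℝ)
            + χ (t / L) * deriv U (t / L : ℝ)) * Complex.exp (U (t / L : ℝ))))
          (F'' := (1 / L) • (1 / L) • (((deriv (deriv χ) s : ℝ) + 2 * (deriv χ s : ℝ) * deriv U s
            + χ s * (deriv (deriv U) s + deriv U s ^ 2)) * Complex.exp (U s))) hx0 ?_ ?_]
        · rw [finrank_euclideanSpace_fin, hxs, mul_div_cancel_left₀ _ hL.ne']
          simp only [Complex.real_smul]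
          have : (L : ℂ) ≠ 0 := by exact_mod_cast hL.ne'
          have : (s : ℂ) ≠ 0 := by exact_mod_cast hs0.ne'
          push_cast
          field_simp
        · have hc : ContinuousAt (fun t : ℝ => |t / L - a|) ‖x‖ := by fun_prop
          filter_upwards [hc.eventually (gt_mem_nhds hsr)] with t ht
          exact (hasDerivAt_mul_cexp hχs isOpen_ball hU (ofReal_mem_ball.2 ht)).1.scomp t (hdil t)
        · have hd := (hasDerivAt_mul_cexp hχs isOpen_ball hU hmem).2.scomp ‖x‖ (hdil ‖x‖)
          exact hd.const_smul (1 / L)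
      have hσL' : ((L : ℂ) ^ 2)⁻¹ = σ * h ^ 2 := by
        have h5 : (σ : ℂ) * h ^ 2 * L ^ 2 = 1 := by exact_mod_cast hσL
        exact inv_eq_of_mul_eq_one_left h5
      -- The first part is the residual of the radial equation times `φ`; the second collects all
      -- terms with a derivative of `χ`, and so is zero for `|s - a| < r / 4`.
      have key : -(Δ ⇑φ) x + V x * φ x - σ * z * φ x
          = -(σ * ((h ^ 2 * (deriv (deriv U) s + deriv U s ^ 2
            + 2 * (((N : ℝ) - 1) / 2 : ℝ) / s * deriv U s) + g s) * φ x))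
            - σ * ((h ^ 2 * (deriv (deriv χ) s : ℝ) + 2 * (deriv χ s : ℝ) * (h * (h * deriv U s))
              + h ^ 2 * (((N : ℝ) - 1 : ℝ) / s) * (deriv χ s : ℝ)) * Complex.exp (U s)) := by
        rw [hlap, hV s hsr x hxs, hφ x, hσL']
        simp only [hΦ, ← hs]
        push_cast
        ring
      rw [key]
      refine (norm_sub_le _ _).trans (add_le_add ?_ ?_)
      · rw [norm_neg, norm_mul, norm_mul, Complex.norm_real, Real.norm_of_nonneg hσ.le, mul_assoc]
        gcongr
        exact hUη s hmem
      · rcases lt_or_ge |s - a| (r / 4) with hs4 | hs4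
        · have hloc : (χ : ℝ → ℝ) =ᶠ[𝓝 s] fun _ => 1 := by
            have hc : ContinuousAt (fun t : ℝ => |t - a|) s := by fun_prop
            filter_upwards [hc.eventually (gt_mem_nhds hs4)] with t ht
            exact hχ1 t ht.le
          have d1 : deriv χ s = 0 := by rw [hloc.deriv_eq, deriv_const]
          have d2 : deriv (deriv χ) s = 0 := by
            rw [hloc.deriv.deriv_eq]; simp
          rw [d1, d2]
          simpa using hind
        · have hxb : x ∈ ball (0 : EuclideanSpace ℝ (Fin N)) (L * (a + r)) := by
            rw [mem_ball_zero_iff, hxs]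
            rw [abs_lt] at hsr
            gcongr
            linarith
          rw [Set.indicator_of_mem hxb, norm_mul, norm_mul, Complex.norm_real,
            Real.norm_of_nonneg hσ.le, Complex.norm_exp, mul_assoc σ B]
          have hh2 : h ^ 2 ≤ 1 := pow_le_one₀ hh.le hh1
          have hhn : ‖(h : ℂ)‖ = h := by rw [Complex.norm_real, Real.norm_of_nonneg hh.le]
          gcongr
          · refine (norm_add₃_le).trans ?_
            rw [hB]
            refine add_le_add (add_le_add ?_ ?_) ?_
            · rw [norm_mul, norm_pow, hhn, Complex.norm_real, Real.norm_eq_abs]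
              calc _ ≤ 1 * C := by gcongr; exact hC2 s
                _ = C := one_mul C
            · rw [norm_mul, norm_mul, norm_mul (h : ℂ), hhn, Complex.norm_real, Real.norm_eq_abs,
                Complex.norm_ofNat]
              calc _ ≤ 2 * C * (1 * K) := by gcongr; exacts [hC1 s, hUK s hmem]
                _ = _ := by ring
            · rw [norm_mul, norm_mul, norm_pow, hhn, norm_div, Complex.norm_real, Complex.norm_real,
                Complex.norm_real, Real.norm_eq_abs, Real.norm_eq_abs, Real.norm_eq_abs,
                abs_of_pos hs0]
              calc _ ≤ 1 * (|(N : ℝ) - 1| / (a - r)) * C := by gcongr; exact hC1 s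
                _ = _ := by ring
          · exact hup s hs4 hsr
    · have hloc : (φ : EuclideanSpace ℝ (Fin N) → ℂ) =ᶠ[𝓝 x] fun _ => 0 := by
        have hc : ContinuousAt (fun y : EuclideanSpace ℝ (Fin N) => |‖y‖ / L - a|) x := by fun_prop
        filter_upwards [hc.eventually (lt_mem_nhds (show r / 2 < |‖x‖ / L - a| by linarith))]
          with y hy
        rw [hφ, hΦ]
        simp [hχ0 _ hy.le]
      have hl : (Δ ⇑φ) x = 0 := by
        rw [(InnerProductSpace.laplacian_congr_nhds hloc).eq_of_nhds]
        simp
      rw [hl, hloc.eq_of_nhds]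
      simpa using hind
  · filter_upwards [hf] with x h1 hx
    rw [h1, hnormφ]
    have hs : |‖x‖ / L - a| ≤ ε := by
      rw [mem_ball, dist_eq_norm] at hx
      have h2 := (abs_norm_sub_norm_le x y).trans hx.le
      rw [hyn] at h2
      have : ‖x‖ / L - a = (‖x‖ - L * a) / L := by field_simp
      rw [this, abs_div, abs_of_pos hL, div_le_iff₀ hL]
      linarith
    rw [hχ1 _ (hs.trans hεr), abs_one, one_mul]
    exact Real.exp_le_exp.2 (hlow _ hs)

end SchrodingerPseudospectrum

namespace SchrodingerPseudospectrum
open Metric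

/-! ### Scaling, choice of parameters and conclusion -/

/-- A complex number in the open cone between the positive half-line and the ray through `c`. -/
theorem exists_cone_decomposition {c z : ℂ} (hc_re : 0 < c.re) (hc_im : 0 < c.im)
    (hz : 0 < z.arg) (hz' : z.arg < c.arg) :
    ∃ E t : ℝ, 0 < E ∧ 0 < t ∧ z = E + c * t := by
  have hcπ : c.arg < Real.pi / 2 := by
    have := Complex.abs_arg_lt_pi_div_two_iff.2 (Or.inl hc_re)
    exact (abs_lt.1 this).2
  have hz0 : z ≠ 0 := by
    rintro rfl
    simp at hz
  have hc0 : c ≠ 0 := by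
    rintro rfl
    simp at hc_re
  have hpz : 0 < ‖z‖ := norm_pos_iff.2 hz0
  have hpc : 0 < ‖c‖ := norm_pos_iff.2 hc0
  have hzim : 0 < z.im := by
    rw [← Complex.norm_mul_sin_arg]
    exact mul_pos hpz (Real.sin_pos_of_pos_of_lt_pi hz (by linarith [Real.pi_pos]))
  -- This quantity is `‖z‖ ‖c‖ sin(arg c - arg z)`.
  have hE : 0 < z.re * c.im - c.re * z.im := by
    have h1 : 0 < Real.sin (c.arg - z.arg) :=
      Real.sin_pos_of_pos_of_lt_pi (by linarith) (by linarith [Real.pi_pos])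
    rw [Real.sin_sub] at h1
    rw [← Complex.norm_mul_sin_arg z, ← Complex.norm_mul_cos_arg z, ← Complex.norm_mul_sin_arg c,
      ← Complex.norm_mul_cos_arg c]
    have := mul_pos (mul_pos hpz hpc) h1
    linarith
  refine ⟨(z.re * c.im - c.re * z.im) / c.im, z.im / c.im, by positivity, by positivity, ?_⟩
  apply Complex.ext
  · rw [Complex.add_re, Complex.ofReal_re, Complex.re_mul_ofReal]
    field_simp
    ring
  · rw [Complex.add_im, Complex.ofReal_im, Complex.im_mul_ofReal]
    field_simp
    ring

/-- The holomorphic extension of `z` minus the rescaled radial potential. -/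
noncomputable def scaledSymbol (n : ℕ) (c : ℕ → ℂ) (p : ℕ → ℝ) (z : ℂ) (σ : ℝ) (s : ℂ) : ℂ :=
  z - ∑ m ∈ Finset.Icc 1 n, c m * ((σ ^ (p m / p n - 1) : ℝ) : ℂ) * s ^ (p m : ℂ)

theorem ball_subset_slitPlane {a r : ℝ} (hra : r ≤ a) :
    ball (a : ℂ) r ⊆ Complex.slitPlane := by
  intro s hs
  rw [mem_ball, Complex.dist_eq] at hs
  have := (Complex.abs_re_le_norm (s - a)).trans_lt hs
  rw [Complex.sub_re, Complex.ofReal_re, abs_lt] at this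
  exact Or.inl (by linarith)

theorem differentiableOn_scaledSymbol (n : ℕ) (c : ℕ → ℂ) (p : ℕ → ℝ) (z : ℂ) (σ : ℝ) {O : Set ℂ}
    (hO : O ⊆ Complex.slitPlane) : DifferentiableOn ℂ (scaledSymbol n c p z σ) O := by
  refine (differentiableOn_const _).sub (DifferentiableOn.fun_sum fun m _ => ?_)
  exact ((differentiableOn_id.cpow (differentiableOn_const _) fun s hs => hO hs).const_mul _)

theorem potential_eq_scaledSymbol {N n : ℕ} {c : ℕ → ℂ} {p : ℕ → ℝ} (z : ℂ)
    {σ s : ℝ} (hσ : 0 < σ) (hs : 0 < s) {x : EuclideanSpace ℝ (Fin N)}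
    (hx : ‖x‖ = σ ^ (1 / p n) * s) :
    potential N n c p x = σ * (z - scaledSymbol n c p z σ s) := by
  rw [potential, scaledSymbol, sub_sub_cancel, Finset.mul_sum]
  refine Finset.sum_congr rfl fun m _ => ?_
  have h1 : ‖x‖ ^ p m = σ * (σ ^ (p m / p n - 1) * s ^ p m) := by
    rw [hx, Real.mul_rpow (by positivity) hs.le, ← Real.rpow_mul hσ.le, ← mul_assoc]
    congr 1
    rw [Real.rpow_sub_one hσ.ne', mul_div_cancel₀ _ hσ.ne', one_div_mul_eq_div]
  rw [h1, ← Complex.ofReal_cpow hs.le]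
  push_cast
  ring

/-- For `m < n` the exponent `p m / p n - 1` of `σ` is negative, and `s ^ p m` is bounded on the
closed disc, which avoids the origin, whatever the sign of `p m`. -/
theorem scaledSymbol_tendsto {n : ℕ} (hn : 1 ≤ n) {c : ℕ → ℂ} {p : ℕ → ℝ} (hpn : 0 < p n)
    (hp : StrictMonoOn p (Set.Icc 1 n)) (z : ℂ) {a r : ℝ} (hra : r < a) {τ : ℝ} (hτ : 0 < τ) :
    ∀ᶠ σ : ℝ in atTop, ∀ s ∈ ball (a : ℂ) r,
      ‖scaledSymbol n c p z σ s - (z - c n * s ^ (p n : ℂ))‖ ≤ τ := by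
  have hbd : ∀ m, ∃ B : ℝ, ∀ s ∈ closedBall (a : ℂ) r, ‖s ^ (p m : ℂ)‖ ≤ B := fun m => by
    refine (isCompact_closedBall (a : ℂ) r).exists_bound_of_continuousOn ?_
    refine continuousOn_id.cpow continuousOn_const fun s hs => ?_
    exact ball_subset_slitPlane le_rfl (closedBall_subset_ball hra hs)
  choose B hB using hbd
  have hnI : n ∈ Finset.Icc 1 n := Finset.mem_Icc.2 ⟨hn, le_rfl⟩
  have hlim : Tendsto (fun σ : ℝ => ∑ m ∈ (Finset.Icc 1 n).erase n,
      ‖c m‖ * σ ^ (p m / p n - 1) * B m) atTop (𝓝 0) := by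
    rw [← Finset.sum_const_zero (s := (Finset.Icc 1 n).erase n)]
    refine tendsto_finsetSum _ fun m hm => ?_
    rw [Finset.mem_erase, Finset.mem_Icc] at hm
    have hlt : p m < p n := hp ⟨hm.2.1, hm.2.2⟩ ⟨hn, le_rfl⟩ (lt_of_le_of_ne hm.2.2 hm.1)
    have hneg : 0 < -(p m / p n - 1) := by
      have : p m / p n < 1 := (div_lt_one hpn).2 hlt
      linarith
    have := ((tendsto_rpow_neg_atTop hneg).const_mul ‖c m‖).mul_const (B m)
    simpa using this
  filter_upwards [hlim.eventually (ge_mem_nhds hτ), eventually_gt_atTop 0] with σ h1 hσ s hs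
  have e : scaledSymbol n c p z σ s - (z - c n * s ^ (p n : ℂ))
      = -∑ m ∈ (Finset.Icc 1 n).erase n, c m * ((σ ^ (p m / p n - 1) : ℝ) : ℂ) * s ^ (p m : ℂ) := by
    rw [scaledSymbol, ← Finset.add_sum_erase _ _ hnI, div_self hpn.ne', sub_self, Real.rpow_zero]
    push_cast
    ring
  rw [e, norm_neg]
  refine (norm_sum_le_of_le _ fun m _ => ?_).trans h1
  rw [norm_mul, norm_mul, Complex.norm_real, Real.norm_of_nonneg (by positivity)]
  gcongr
  exact hB m s (ball_subset_closedBall hs)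

/-- Approximate eigenvectors at `σ z`, up to an error of any polynomial order in `σ`. -/
theorem exists_approx_eigenvector {N : ℕ} (hN : 1 ≤ N) {n : ℕ} (hn : 1 ≤ n) {c : ℕ → ℂ}
    {p : ℕ → ℝ} (hc_re : 0 < (c n).re) (hc_im : 0 < (c n).im) (hpn : 0 < p n)
    (hp : StrictMonoOn p (Set.Icc 1 n)) {H : L2 N →ₗ.[ℂ] L2 N}
    (hH : IsExtension (potential N n c p) H) {z : ℂ} (hz : 0 < z.arg) (hz' : z.arg < (c n).arg)
    (k : ℝ) :
    ∀ᶠ σ : ℝ in atTop, ∃ f : H.domain, 0 < ‖(f : L2 N)‖ ∧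
      ‖H f - ((σ : ℂ) * z) • (f : L2 N)‖ ≤ σ ^ (-k) * ‖(f : L2 N)‖ := by
  obtain ⟨E, t, hE, ht, hzE⟩ := exists_cone_decomposition hc_re hc_im hz hz'
  set a : ℝ := t ^ (1 / p n) with ha
  have ha0 : 0 < a := by positivity
  have hat : a ^ p n = t := by
    rw [ha, ← Real.rpow_mul ht.le, one_div_mul_cancel hpn.ne', Real.rpow_one]
  set g₀ : ℂ → ℂ := fun s => z - c n * s ^ (p n : ℂ) with hg₀
  have hg₀real : ∀ s : ℝ, 0 < s → g₀ s = z - c n * (s ^ p n : ℝ) := fun s hs => by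
    rw [hg₀, Complex.ofReal_cpow hs.le]
  have hg₀d : DifferentiableOn ℂ g₀ Complex.slitPlane :=
    (differentiableOn_const _).sub
      ((differentiableOn_id.cpow (differentiableOn_const _) fun s hs => hs).const_mul _)
  have hg₀a : g₀ a = E := by
    rw [hg₀real a ha0, hat, hzE]
    ring
  obtain ⟨r, hr, hra, hrE⟩ : ∃ r > 0, r < a ∧ ∀ s ∈ ball (a : ℂ) r, ‖g₀ s - E‖ ≤ E / 4 := by
    have hmem : (a : ℂ) ∈ Complex.slitPlane := Complex.ofReal_mem_slitPlane.2 ha0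
    have hc := (hg₀d.differentiableAt (Complex.isOpen_slitPlane.mem_nhds hmem)).continuousAt
    obtain ⟨r, hr, h⟩ := Metric.continuousAt_iff.1 hc (E / 4) (by positivity)
    refine ⟨min r (a / 2), by positivity, (min_le_right _ _).trans_lt (by linarith), fun s hs => ?_⟩
    have := h ((mem_ball.1 hs).trans_le (min_le_left _ _))
    rw [hg₀a, dist_eq_norm] at this
    exact this.le
  -- Chosen so that `σ h² L² = 1` with `L = σ ^ (1 / p n)`.
  set q : ℝ := 1 / 2 + 1 / p n with hq
  have hq2 : 1 / 2 < q := by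
    have : 0 < 1 / p n := by positivity
    linarith
  set h : ℝ → ℝ := fun σ => σ ^ (-q) with hh
  have hpos : ∀ᶠ σ in atTop, 0 < h σ := by
    filter_upwards [eventually_gt_atTop 0] with σ hσ
    rw [hh]
    positivity
  have hsub : ball (a : ℂ) r ⊆ Complex.slitPlane := ball_subset_slitPlane hra.le
  obtain ⟨ε, κ, hε, hεr, hκ, hphase⟩ := exists_phase (l := atTop) hpos
    (tendsto_rpow_neg_atTop (by linarith)) hr hra hE (((N : ℝ) - 1) / 2)
    (g := scaledSymbol n c p z) (g₀ := g₀)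
    (fun σ => differentiableOn_scaledSymbol n c p z σ hsub) (hg₀d.mono hsub) hrE
    (fun τ hτ => scaledSymbol_tendsto hn hpn hp z hra hτ) (fun s hs hsa => by
      have hs0 : 0 < s := by rw [abs_lt] at hs; linarith
      have hzim : z.im = (c n).im * a ^ p n := by
        rw [hat, hzE, Complex.add_im, Complex.ofReal_im, Complex.im_mul_ofReal, zero_add]
      rw [hg₀real s hs0, Complex.sub_im, Complex.im_mul_ofReal, hzim, ← mul_sub, mul_assoc]
      refine mul_pos hc_im ?_
      rcases lt_or_gt_of_ne hsa with hlt | hlt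
      · exact mul_pos (sub_pos.2 (Real.rpow_lt_rpow hs0.le hlt hpn)) (sub_pos.2 hlt)
      · exact mul_pos_of_neg_of_neg (sub_neg.2 (Real.rpow_lt_rpow ha0.le hlt hpn)) (sub_neg.2 hlt))
  -- Since `q > 1/2`, this gives `h ^ (M + 1) ≤ σ ^ (-k - 2)`. The two spare powers pay for the
  -- prefactor `σ` and for the constant `D ≤ σ`.
  obtain ⟨M, hM⟩ := exists_nat_ge (2 * (k + 2))
  obtain ⟨K, hK, hev⟩ := hphase M
  let χ : ContDiffBump a := ⟨r / 4, r / 2, by linarith, by linarith⟩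
  have hχ' : ContDiff ℝ (⊤ : ℕ∞) (deriv χ) := (contDiff_infty_iff_deriv.1 χ.contDiff).2
  obtain ⟨C₁, hC₁⟩ := hχ'.continuous.bounded_above_of_compact_support χ.hasCompactSupport.deriv
  obtain ⟨C₂, hC₂⟩ := (contDiff_infty_iff_deriv.1 hχ').2.continuous.bounded_above_of_compact_support
    χ.hasCompactSupport.deriv.deriv
  set C := max C₁ C₂ with hC
  have hC0 : 0 ≤ C := ((norm_nonneg _).trans (hC₁ a)).trans (le_max_left _ _)
  have har : 0 < a - r := by linarith
  set B := C + 2 * C * K + |(N : ℝ) - 1| / (a - r) * C with hB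
  have hB0 : 0 ≤ B := by positivity
  set D := K + B * ((M + 1).factorial / κ ^ (M + 1)) * ((a + r) / ε) ^ N with hD
  filter_upwards [hev, hpos, eventually_ge_atTop 1, eventually_ge_atTop D]
    with σ ⟨U, hU, hUK, hUη, hlow, hup⟩ h0 hσ1 hσD
  have hσ : 0 < σ := by linarith
  obtain ⟨f, hf, hfle⟩ := exists_quasimode hN hH (σ := σ) (h := h σ) (L := σ ^ (1 / p n))
    (η := K * h σ ^ (M + 1)) (χ := χ) (C := C) (z := z) hσ h0
    (Real.rpow_le_one_of_one_le_of_nonpos hσ1 (by linarith)) (by positivity) (by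
      rw [hh, ← Real.rpow_natCast, ← Real.rpow_natCast, ← Real.rpow_mul hσ.le,
        ← Real.rpow_mul hσ.le]
      nth_rewrite 1 [← Real.rpow_one σ]
      rw [← Real.rpow_add hσ, ← Real.rpow_add hσ, show 1 + -q * (2 : ℕ) + 1 / p n * (2 : ℕ) = 0 by
        rw [hq]; push_cast; ring, Real.rpow_zero]) hr hra hε hεr hK (by positivity) rfl rfl (fun s => (hC₁ s).trans (le_max_left _ _))
    (fun s => (hC₂ s).trans (le_max_right _ _)) hU
    (fun s hs x hx => potential_eq_scaledSymbol z hσ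
      (by rw [abs_lt] at hs; linarith) hx) hUK hUη hlow hup
  refine ⟨f, hf, hfle.trans ?_⟩
  gcongr
  -- Keep only the term of degree `M + 1` in the series of `exp(κ/h)`, then invert.
  have hexp : Real.exp (-κ / h σ) ≤ (M + 1).factorial / κ ^ (M + 1) * h σ ^ (M + 1) := by
    have h1 := Real.pow_div_factorial_le_exp (κ / h σ) (by positivity) (M + 1)
    rw [neg_div, Real.exp_neg]
    refine (inv_anti₀ (by positivity) h1).trans (le_of_eq ?_)
    rw [div_pow]
    field_simp
  have hhM : h σ ^ (M + 1) ≤ σ ^ (-k - 2) := by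
    rw [hh, ← Real.rpow_natCast, ← Real.rpow_mul hσ.le]
    refine Real.rpow_le_rpow_of_exponent_le hσ1 ?_
    push_cast
    have hM0 : (0 : ℝ) ≤ M := M.cast_nonneg
    nlinarith
  calc σ * (K * h σ ^ (M + 1) + B * Real.exp (-κ / h σ) * ((a + r) / ε) ^ N)
      ≤ σ * (K * h σ ^ (M + 1)
        + B * ((M + 1).factorial / κ ^ (M + 1) * h σ ^ (M + 1)) * ((a + r) / ε) ^ N) := by gcongr
    _ = σ * D * h σ ^ (M + 1) := by rw [hD]; ring
    _ ≤ σ * σ * σ ^ (-k - 2) := by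
        have : 0 ≤ D := by positivity
        gcongr
    _ = σ ^ (-k) := by
        rw [← pow_two, ← Real.rpow_natCast, ← Real.rpow_add hσ]
        congr 1
        push_cast
        ring

/-- An approximate eigenvector bounds the resolvent norm from below. -/
theorem le_resolventNorm {E : Type*} [NormedAddCommGroup E] [NormedSpace ℂ E] {H : E →ₗ.[ℂ] E}
    {w : ℂ} {δ : ℝ} (hδ : 0 < δ) {f : H.domain} (hf : 0 < ‖(f : E)‖)
    (hle : ‖H f - w • (f : E)‖ ≤ δ * ‖(f : E)‖) : ENNReal.ofReal δ⁻¹ ≤ resolventNorm H w := by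
  refine le_iInf₂ fun R hR => ?_
  rw [← ofReal_norm]
  refine ENNReal.ofReal_le_ofReal ?_
  have h1 := R.le_opNorm (H f - w • (f : E))
  rw [hR.2 f] at h1
  have h2 : ‖(f : E)‖ * 1 ≤ ‖(f : E)‖ * (‖R‖ * δ) := by
    calc _ ≤ ‖R‖ * (δ * ‖(f : E)‖) := by rw [mul_one]; exact h1.trans (by gcongr)
      _ = _ := by ring
  exact (inv_le_iff_one_le_mul₀ hδ).2 (le_of_mul_le_mul_left h2 hf)

end SchrodingerPseudospectrum

theorem theorem3 (N : ℕ) (hN : 1 ≤ N) (n : ℕ) (hn : 1 ≤ n) (c : ℕ → ℂ) (p : ℕ → ℝ)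
    (hc_re : 0 < (c n).re) (hc_im : 0 < (c n).im) (hpn : 0 < p n)
    (hp1 : -2 ≤ p 1) (hp : StrictMonoOn p (Set.Icc 1 n))
    (H : SchrodingerPseudospectrum.L2 N →ₗ.[ℂ] SchrodingerPseudospectrum.L2 N)
    (hHclosed : H.IsClosed)
    (hHext : SchrodingerPseudospectrum.IsExtension
      (SchrodingerPseudospectrum.potential N n c p) H)
    (z : ℂ) (hz : 0 < z.arg) (hz' : z.arg < (c n).arg) (k : ℝ) :
    Tendsto
      (fun σ : ℝ => SchrodingerPseudospectrum.resolventNorm H ((σ : ℂ) * z) /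
        ENNReal.ofReal (σ ^ k))
      atTop (𝓝 ∞) := by
  -- Quasimodes of order `k + 1` make the quotient at least `σ`, which already tends to infinity.
  refine tendsto_nhds_top_mono ENNReal.tendsto_ofReal_atTop ?_
  filter_upwards [SchrodingerPseudospectrum.exists_approx_eigenvector hN hn hc_re hc_im hpn hp hHext
    hz hz' (k + 1), eventually_gt_atTop 0] with σ ⟨f, hf, hle⟩ hσ
  have h1 := SchrodingerPseudospectrum.le_resolventNorm (by positivity) hf hle
  rw [Real.rpow_neg hσ.le, inv_inv] at h1
  have hk : 0 < σ ^ k := by positivity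
  rw [ENNReal.le_div_iff_mul_le (Or.inl (by simpa using hk)) (Or.inl ENNReal.ofReal_ne_top),
    ← ENNReal.ofReal_mul hσ.le, mul_comm, ← Real.rpow_add_one hσ.ne']
  exact h1
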